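/- **Setting.** Let $\mathbb{O}=\mathbb{H}+\ell\mathbb{H}\cong\mathbb{R}^8$ be the octonions, with product $(a+\ell b)(c+\ell d)=ac-d\bar b+\ell(\bar a d+cb)$ and conjugation $(a+\ell b)^c=\bar a-\ell b$, let $\mathrm{Re}(x)=\frac12(x+x^c)$, $\mathrm{Im}(x)=\frac12(x-x^c)$, and let $\mathbb{S}=\{J\in\mathbb{O}: J+J^c=0,\ JJ^c=1\}$ be the $6$-sphere of imaginary units. For $x=\alpha+\beta J$ ($\alpha,\beta\in\mathbb{R}$, $J\in\mathbb{S}$) put $\mathbb{S}_x=\alpha+\beta\mathbb{S}$; this is a $6$-sphere if $x\notin\mathbb{R}$. Let $\mathbb{O}_{\mathbb{C}}=\mathbb{O}\otimes_{\mathbb{R}}\mathbb{C}=\{x+\iota y\}$, with $(x+\iota y)(x'+\iota y')=xx'-yy'+\iota(xy'+yx')$, $(x+\iota y)^c=x^c+\iota y^c$ and $\overline{x+\iota y}=x-\iota y$. Let $D\subseteq\mathbb{C}$ be a nonempty open set invariant under complex conjugation, and let $\Omega=\Omega_D=\{\alpha+\beta J:\alpha+i\beta\in D,\ J\in\mathbb{S}\}$.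 One calls $\Omega$ a *slice domain* if $D$ is connected and meets $\mathbb{R}$, and a *product domain* if $D\cap\mathbb{R}=\emptyset$ and $D$ has exactly two connected components, interchanged by conjugation. A function $f:\Omega\to\mathbb{O}$ is *slice regular* if there is a $C^1$ map $F=F_1+\iota F_2:D\to\mathbb{O}_{\mathbb{C}}$ with $F(\bar z)=\overline{F(z)}$ and $\frac{\partial F}{\partial\alpha}+\iota\frac{\partial F}{\partial\beta}\equiv0$ on $D$, such that $f(\alpha+\beta J)=F_1(\alpha+i\beta)+JF_2(\alpha+i\beta)$ for all $\alpha+i\beta\in D$ and $J\in\mathbb{S}$; one writes $f=\mathcal{I}(F)$, and $F$ is unique. The *normal function* of $f$ is $N(f)=\mathcal{I}(FF^c)$. Its *degenerate set* $D_f\subseteq\Omega\setminus\mathbb{R}$ is the zero set of the spherical derivative $f'_s(x)=\frac12\,\mathrm{Im}(x)^{-1}(f(x)-f(x^c))$, $x\in\Omega\setminus\mathbb{R}$, and its *singular set* $N_f$ is the set of $x\in\Omega$ at which the real differential $df_x$ is not invertible. A subset $S$ of a set $A\subseteq\mathbb{O}$ is *isolated in* $A$ if $A\cap U=S$ for some open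 $U\subseteq\mathbb{O}$. A *real analytic subset* of $\Omega$ is the zero set of a real analytic function $\Omega\to\mathbb{R}$. **Theorem.** Let $\Omega$ be either a slice domain or a product domain, let $f:\Omega\to\mathbb{O}$ be a nonconstant slice regular function and let $c\in f(\Omega)$. 1. If $N(f-c)\not\equiv0$ on $\Omega$, then $f^{-1}(c)$ consists of isolated points and isolated $6$-spheres: for each $x\in f^{-1}(c)$, either $\{x\}$ is isolated in $f^{-1}(c)$, or $x\notin\mathbb{R}$ and $\mathbb{S}_x$ is contained and isolated in $f^{-1}(c)$. Moreover, the union of all $6$-spheres $\mathbb{S}_{x_0}$, $x_0\in\Omega\setminus\mathbb{R}$, that are contained and isolated in $f^{-1}(c)$ equals $f^{-1}(c)\cap D_f$. 2. If $N(f-c)\equiv0$ on $\Omega$, then there is a set $W_{f,c}\subseteq f^{-1}(c)$ that is a real analytic subset of $\Omega$ and a nonempty embedded real analytic surface (of real dimension $2$), such that $$f^{-1}(c)\setminus D_f=W_{f,c}\setminus D_f ,$$ while $f^{-1}(c)\cap D_f$ is a (possibly empty) union of $6$-spheres $\mathbb{S}_{x_0}$, $x_0\in\Omega\setminus\mathbb{R}$,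 each of which is isolated in $f^{-1}(c)\cap D_f$. Moreover, $W_{f,c}\subseteq N_f$. If $\Omega$ is a slice domain, then $N(f-c)\not\equiv0$; that is, case 2 does not occur. -/

import Mathlib

noncomputable section

namespace SliceReg

/-! ### The octonions -/

/-- The real algebra of octonions `𝕆 = ℍ + ℓℍ`; the pair `(a, b)` stands for `a + ℓ b`.
As a normed space it is `ℍ × ℍ = ℝ⁸` with the Euclidean norm. -/
def Octonion : Type := WithLp 2 (Quaternion ℝ × Quaternion ℝ)

namespace Octonion

instance : NormedAddCommGroup Octonion :=
  inferInstanceAs (NormedAddCommGroup (WithLp 2 (Quaternion ℝ × Quaternion ℝ)))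

instance : InnerProductSpace ℝ Octonion :=
  inferInstanceAs (InnerProductSpace ℝ (WithLp 2 (Quaternion ℝ × Quaternion ℝ)))

/-- The octonion `a + ℓ b`. -/
def mk (a b : Quaternion ℝ) : Octonion := WithLp.toLp 2 (a, b)

/-- The component `a` of `a + ℓ b`. -/
def fst (x : Octonion) : Quaternion ℝ := (WithLp.ofLp x).1

/-- The component `b` of `a + ℓ b`. -/
def snd (x : Octonion) : Quaternion ℝ := (WithLp.ofLp x).2

instance : One Octonion := ⟨mk 1 0⟩

/-- Cayley–Dickson product: `(a + ℓ b)(c + ℓ d) = (a c - d bᶜ) + ℓ (aᶜ d + c b)`. -/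
instance : Mul Octonion :=
  ⟨fun x y => mk (x.fst * y.fst - y.snd * star x.snd) (star x.fst * y.snd + y.fst * x.snd)⟩

/-- Conjugation: `(a + ℓ b)ᶜ = aᶜ - ℓ b`. -/
instance : Star Octonion := ⟨fun x => mk (star x.fst) (-x.snd)⟩

/-- The inverse `x⁻¹ = n(x)⁻¹ xᶜ`, where `n(x) = ‖x‖²`. -/
instance : Inv Octonion := ⟨fun x => (‖x‖ ^ 2)⁻¹ • star x⟩

/-- The real part, as a real number. -/
def re (x : Octonion) : ℝ := x.fst.re

/-- The imaginary part `x - Re x = (x - xᶜ) / 2`. -/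
def im (x : Octonion) : Octonion := (1 / 2 : ℝ) • (x - star x)

/-- The real axis inside the octonions. -/
def reals : Set Octonion := Set.range fun r : ℝ => r • (1 : Octonion)

/-- The sphere `𝕊` of imaginary units: trace zero and norm one. -/
def units : Set Octonion := {J | J + star J = 0 ∧ J * star J = 1}

/-- `φ_J (α + i β) = α + β J`. -/
def phi (J : Octonion) (z : ℂ) : Octonion := z.re • (1 : Octonion) + z.im • J

/-- The sphere `𝕊_x = α + β 𝕊` through `x = α + β J`. -/
def sphere (x : Octonion) : Set Octonion :=
  {y | ∃ I ∈ units, y = x.re • (1 : Octonion) + ‖x.im‖ • I}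

end Octonion

open Octonion

/-- The circularization `Ω_E` of a set `E` of complex numbers. -/
def circ (E : Set ℂ) : Set Octonion := {x | ∃ z ∈ E, ∃ J ∈ units, x = phi J z}

/-! ### The complexified algebra -/

/-- The complexification `𝕆_ℂ = 𝕆 ⊗ ℂ`; the pair `(x, y)` stands for `x + ι y`. -/
def OctonionC : Type := Octonion × Octonion

namespace OctonionC

instance : NormedAddCommGroup OctonionC :=
  inferInstanceAs (NormedAddCommGroup (Octonion × Octonion))

instance : NormedSpace ℝ OctonionC :=
  inferInstanceAs (NormedSpace ℝ (Octonion × Octonion))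

/-- The element `x + ι y`. -/
def mk (x y : Octonion) : OctonionC := (x, y)

/-- The component `x` of `x + ι y`. -/
def fst (w : OctonionC) : Octonion := Prod.fst w

/-- The component `y` of `x + ι y`. -/
def snd (w : OctonionC) : Octonion := Prod.snd w

/-- `(x + ι y)(x' + ι y') = (x x' - y y') + ι (x y' + y x')`. -/
instance : Mul OctonionC :=
  ⟨fun w w' => mk (w.fst * w'.fst - w.snd * w'.snd) (w.fst * w'.snd + w.snd * w'.fst)⟩

/-- `(x + ι y)ᶜ = xᶜ + ι yᶜ`. -/
instance : Star OctonionC := ⟨fun w => mk (star w.fst) (star w.snd)⟩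

/-- The element `ι`. -/
def iota : OctonionC := mk 0 1

/-- Complex conjugation `x + ι y ↦ x - ι y`. -/
def bar (w : OctonionC) : OctonionC := mk w.fst (-w.snd)

/-- `φ_J (x + ι y) = x + J y`. -/
def phi (J : Octonion) (w : OctonionC) : Octonion := w.fst + J * w.snd

end OctonionC

/-! ### Slice functions and slice regular functions

Functions are total; only their values on `D`, respectively on `circ D`, matter. -/

/-- `D` is invariant under complex conjugation. -/
def ConjInvariant (D : Set ℂ) : Prop := ∀ z ∈ D, (starRingEnd ℂ) z ∈ D

/-- `F` is a stem function on `D`. -/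
def IsStem (D : Set ℂ) (F : ℂ → OctonionC) : Prop :=
  ∀ z ∈ D, F ((starRingEnd ℂ) z) = (F z).bar

/-- `f` is induced on `circ D` by the function `F` on `D`. -/
def Induces (D : Set ℂ) (F : ℂ → OctonionC) (f : Octonion → Octonion) : Prop :=
  ∀ J ∈ units, ∀ z ∈ D, f (phi J z) = OctonionC.phi J (F z)

/-- `∂F/∂z̄ = (∂F/∂α + ι ∂F/∂β) / 2`. -/
def dbar (F : ℂ → OctonionC) (z : ℂ) : OctonionC :=
  (1 / 2 : ℝ) • (fderiv ℝ F z 1 + OctonionC.iota * fderiv ℝ F z Complex.I)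

/-- `F` is holomorphic on the open set `D`. -/
def IsHolomorphic (D : Set ℂ) (F : ℂ → OctonionC) : Prop :=
  ContDiffOn ℝ 1 F D ∧ ∀ z ∈ D, dbar F z = 0

/-- `f` is slice regular on `circ D`: it is induced by a holomorphic stem function. -/
def IsSliceRegular (D : Set ℂ) (f : Octonion → Octonion) : Prop :=
  ∃ F : ℂ → OctonionC, IsStem D F ∧ IsHolomorphic D F ∧ Induces D F f

/-- The stem function on `D` that induces the slice function `f` on `circ D`;
its values on `D` are uniquely determined by `f`. -/
def stemOf (D : Set ℂ) (f : Octonion → Octonion) : ℂ → OctonionC :=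
  Classical.epsilon fun F => IsStem D F ∧ Induces D F f

/-- The slice function `𝓘(F)` induced by a stem function `F`, evaluated at
`x = α + β J` with `α = Re x`, `β = |Im x|`, `J = Im x / |Im x|`. At real `x` the term
with `J` is absent, since there the second component of a stem function is `0`. -/
def inducedFun (F : ℂ → OctonionC) (x : Octonion) : Octonion :=
  OctonionC.phi (‖x.im‖⁻¹ • x.im) (F ⟨x.re, ‖x.im‖⟩)

/-- The normal function `N(f) = 𝓘(F Fᶜ)` of the slice function `f = 𝓘(F)` on `circ D`. -/
def normalFun (D : Set ℂ) (f : Octonion → Octonion) : Octonion → Octonion :=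
  inducedFun fun z => stemOf D f z * star (stemOf D f z)

/-- The spherical derivative `f'ₛ(x) = ½ Im(x)⁻¹ (f(x) - f(xᶜ))`, for nonreal `x`. -/
def sphDeriv (f : Octonion → Octonion) (x : Octonion) : Octonion :=
  (1 / 2 : ℝ) • ((x.im)⁻¹ * (f x - f (star x)))

/-- The degenerate set `D_f`: the zero set of the spherical derivative in `Ω ∖ ℝ`. -/
def degenerateSet (Ω : Set Octonion) (f : Octonion → Octonion) : Set Octonion :=
  {x | x ∈ Ω \ reals ∧ sphDeriv f x = 0}

/-- The singular set `N_f`: the points of `Ω` where the real differential of `f` is not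
invertible. -/
def singularSet (Ω : Set Octonion) (f : Octonion → Octonion) : Set Octonion :=
  {x | x ∈ Ω ∧ ∃ L : Octonion →L[ℝ] Octonion, HasFDerivAt f L x ∧ ¬ Function.Bijective L}

/-- The fiber of `f : Ω → 𝕆` over `c`. -/
def fiber (Ω : Set Octonion) (f : Octonion → Octonion) (c : Octonion) : Set Octonion :=
  {x | x ∈ Ω ∧ f x = c}

/-! ### Slice domains and product domains -/

/-- `circ D` is a slice domain: `D` is open, connected (and nonempty), invariant under
conjugation, and meets the real line. -/
def IsSliceDomain (D : Set ℂ) : Prop :=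
  IsOpen D ∧ ConjInvariant D ∧ IsConnected D ∧ ∃ r : ℝ, (r : ℂ) ∈ D

/-- `circ D` is a product domain: `D` is open, invariant under conjugation, does not meet the
real line, and has two connected components, which conjugation interchanges. -/
def IsProductDomain (D : Set ℂ) : Prop :=
  IsOpen D ∧ ConjInvariant D ∧ (∀ r : ℝ, (r : ℂ) ∉ D) ∧
    ∃ Dp : Set ℂ, IsOpen Dp ∧ IsConnected Dp ∧ Disjoint Dp ((starRingEnd ℂ) '' Dp) ∧
      D = Dp ∪ (starRingEnd ℂ) '' Dp

/-! ### Isolated subsets, analytic subsets and analytic surfaces -/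

/-- `S` is an isolated part of `A`: `S ⊆ A`, and some open set containing `S` contains no
further point of `A`. -/
def IsIsolatedIn (S A : Set Octonion) : Prop := ∃ U : Set Octonion, IsOpen U ∧ A ∩ U = S

/-- `W` is a real analytic subset of the open set `Ω`: the zero set of a real analytic
function `Ω → ℝ`. -/
def IsRealAnalyticSubset (Ω W : Set Octonion) : Prop :=
  ∃ ψ : Octonion → ℝ, AnalyticOnNhd ℝ ψ Ω ∧ W = {x | x ∈ Ω ∧ ψ x = 0}

/-- `W` is a (nonempty, embedded) real analytic surface: near each of its points it is the image
of a real analytic immersion, defined on an open subset of the plane `ℂ = ℝ²`, that is a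
homeomorphism onto its image. -/
def IsRealAnalyticSurface (W : Set Octonion) : Prop :=
  W.Nonempty ∧ ∀ x ∈ W, ∃ (U : Set Octonion) (V : Set ℂ) (σ : ℂ → Octonion),
    IsOpen U ∧ x ∈ U ∧ IsOpen V ∧ AnalyticOnNhd ℝ σ V ∧
      (∀ v ∈ V, Function.Injective (fderiv ℝ σ v)) ∧
      Topology.IsEmbedding (V.domRestrict σ) ∧ σ '' V = W ∩ U

end SliceReg

end

open SliceReg

noncomputable section

namespace SliceReg

namespace Octonion

open scoped Quaternion

/-! After replacing `f` by `f - c`, write the value of its stem function as `x + ι y`. In an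
orthonormal basis the stem function is a holomorphic map `h` from `D` to `ℂ⁸`, and `f` vanishes at
`α + β J` iff `x + J y = 0`. An imaginary unit `J` solving this exists iff `‖x‖ = ‖y‖` and `⟨x, y⟩ =
0`, that is, iff `quad h = 0`; and `quad h` vanishes identically iff `N(f)` does. If `y ≠ 0`, then
`J = -x y⁻¹` is unique; if `y = 0`, then `x = 0` and `f` vanishes on the whole sphere.

If `quad h` is not identically zero, its zeros are isolated, and over each of them lies at most a
point or a sphere (`fiber_isolated`).

If `quad h ≡ 0`, the zeros of `h` itself are still isolated and carry the degenerate spheres.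
Elsewhere `J = -x y⁻¹` is real analytic in `z`. At a zero, write `h = (z - z₀)ⁿ G` with `G z₀ ≠ 0`:
a complex factor does not affect `J`, so `G` defines an analytic continuation
(`exists_analyticAt_unit`). The graph `z ↦ α + β J(z)` over the upper half of `D` is the surface;
`f` is constant along it, so its differential is singular there.

On a slice domain `y = 0` at real points, so `quad h ≡ 0` would give `h = 0` on a real interval,
hence everywhere, and `f` would be constant. -/

@[simp] lemma fst_mk (a b : Quaternion ℝ) : (mk a b).fst = a := rfl
@[simp] lemma snd_mk (a b : Quaternion ℝ) : (mk a b).snd = b := rfl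
@[simp] lemma fst_add (x y : Octonion) : (x + y).fst = x.fst + y.fst := rfl
@[simp] lemma snd_add (x y : Octonion) : (x + y).snd = x.snd + y.snd := rfl
@[simp] lemma fst_sub (x y : Octonion) : (x - y).fst = x.fst - y.fst := rfl
@[simp] lemma snd_sub (x y : Octonion) : (x - y).snd = x.snd - y.snd := rfl
@[simp] lemma fst_neg (x : Octonion) : (-x).fst = -x.fst := rfl
@[simp] lemma snd_neg (x : Octonion) : (-x).snd = -x.snd := rfl
@[simp] lemma fst_smul (r : ℝ) (x : Octonion) : (r • x).fst = r • x.fst := rfl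
@[simp] lemma snd_smul (r : ℝ) (x : Octonion) : (r • x).snd = r • x.snd := rfl
@[simp] lemma fst_zero : (0 : Octonion).fst = 0 := rfl
@[simp] lemma snd_zero : (0 : Octonion).snd = 0 := rfl
@[simp] lemma fst_one : (1 : Octonion).fst = 1 := rfl
@[simp] lemma snd_one : (1 : Octonion).snd = 0 := rfl
@[simp] lemma fst_star (x : Octonion) : (star x).fst = star x.fst := rfl
@[simp] lemma snd_star (x : Octonion) : (star x).snd = -x.snd := rfl
@[simp] lemma fst_mul (x y : Octonion) :
    (x * y).fst = x.fst * y.fst - y.snd * star x.snd := rfl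
@[simp] lemma snd_mul (x y : Octonion) :
    (x * y).snd = star x.fst * y.snd + y.fst * x.snd := rfl

@[ext] lemma ext {x y : Octonion} (h₁ : x.fst = y.fst) (h₂ : x.snd = y.snd) : x = y :=
  (WithLp.ofLp_injective 2) (Prod.ext h₁ h₂)

instance : FiniteDimensional ℝ Octonion :=
  inferInstanceAs (FiniteDimensional ℝ (WithLp 2 (Quaternion ℝ × Quaternion ℝ)))

scoped instance : NonUnitalNonAssocRing Octonion :=
  { (inferInstance : AddCommGroup Octonion) with
    mul := (· * ·)
    left_distrib := fun x y z => by ext <;> simp <;> ring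
    right_distrib := fun x y z => by ext <;> simp <;> ring
    zero_mul := fun x => by ext <;> simp
    mul_zero := fun x => by ext <;> simp }

scoped instance : IsScalarTower ℝ Octonion Octonion :=
  ⟨fun r x y => by ext <;> simp [smul_eq_mul] <;> ring⟩

scoped instance : SMulCommClass ℝ Octonion Octonion :=
  ⟨fun r x y => by ext <;> simp [smul_eq_mul] <;> ring⟩

/-! ### Octonion identities, the multiplicative norm and imaginary units -/

protected lemma one_mul (x : Octonion) : 1 * x = x := by ext <;> simp

lemma inner_eq (x y : Octonion) :
    inner ℝ x y = x.fst.re * y.fst.re + x.fst.imI * y.fst.imI + x.fst.imJ * y.fst.imJ +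
      x.fst.imK * y.fst.imK + (x.snd.re * y.snd.re + x.snd.imI * y.snd.imI +
      x.snd.imJ * y.snd.imJ + x.snd.imK * y.snd.imK) := by
  have h : inner ℝ x y = inner ℝ x.fst y.fst + inner ℝ x.snd y.snd := rfl
  rw [h, Quaternion.inner_def, Quaternion.inner_def]
  simp

lemma norm_sq_eq (x : Octonion) :
    ‖x‖ ^ 2 = x.fst.re ^ 2 + x.fst.imI ^ 2 + x.fst.imJ ^ 2 + x.fst.imK ^ 2 +
      (x.snd.re ^ 2 + x.snd.imI ^ 2 + x.snd.imJ ^ 2 + x.snd.imK ^ 2) := by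
  rw [← real_inner_self_eq_norm_sq, inner_eq]
  ring

/-- This and `mul_star_cancel` are the instances of alternativity that replace associativity: one
gives `J (J x) = -x`, the other the solution of `x + J y = 0`. -/
lemma star_mul_cancel (x y : Octonion) : star x * (x * y) = ‖x‖ ^ 2 • y := by
  rw [norm_sq_eq]
  ext <;> simp <;> ring

lemma mul_star_cancel (x y : Octonion) : (x * star y) * y = ‖y‖ ^ 2 • x := by
  rw [norm_sq_eq]
  ext <;> simp <;> ring

lemma mul_star_self (x : Octonion) : x * star x = ‖x‖ ^ 2 • (1 : Octonion) := by
  rw [norm_sq_eq]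
  ext <;> simp <;> ring

lemma mul_star_add_mul_star (x y : Octonion) :
    x * star y + y * star x = (2 * inner ℝ x y) • (1 : Octonion) := by
  rw [inner_eq]
  ext <;> simp <;> ring

lemma re_mul_star (x y : Octonion) : (x * star y).re = inner ℝ x y := by
  rw [inner_eq]
  simp [re]
  ring

protected lemma norm_star (x : Octonion) : ‖star x‖ = ‖x‖ := by
  rw [← sq_eq_sq₀ (norm_nonneg _) (norm_nonneg _), norm_sq_eq, norm_sq_eq]
  simp

protected lemma norm_mul (x y : Octonion) : ‖x * y‖ = ‖x‖ * ‖y‖ := by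
  rw [← sq_eq_sq₀ (norm_nonneg _) (by positivity), mul_pow, norm_sq_eq, norm_sq_eq, norm_sq_eq]
  simp
  ring

/-- For imaginary `x` this makes `x * y` orthogonal to `y`, the source of the condition `⟨x, y⟩ =
0`. -/
lemma inner_mul_self (x y : Octonion) : inner ℝ (x * y) y = x.re * ‖y‖ ^ 2 := by
  rw [inner_eq, norm_sq_eq]
  simp [re]
  ring

lemma add_star (x : Octonion) : x + star x = (2 * x.re) • (1 : Octonion) := by
  ext <;> simp [re] ; ring

protected lemma norm_one : ‖(1 : Octonion)‖ = 1 := by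
  rw [← sq_eq_sq₀ (norm_nonneg _) (by positivity), norm_sq_eq]
  simp

lemma octonion_one_ne_zero : (1 : Octonion) ≠ 0 := by
  rw [← norm_ne_zero_iff, Octonion.norm_one]; exact one_ne_zero

lemma mem_units_iff {J : Octonion} : J ∈ units ↔ J.re = 0 ∧ ‖J‖ = 1 := by
  have h1 : J * star J = 1 ↔ ‖J‖ = 1 := by
    rw [mul_star_self, ← sub_eq_zero, show ‖J‖ ^ 2 • (1 : Octonion) - 1 =
      (‖J‖ ^ 2 - 1) • (1 : Octonion) by rw [sub_smul, one_smul], smul_eq_zero,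
      or_iff_left octonion_one_ne_zero, sub_eq_zero, pow_eq_one_iff_of_nonneg (norm_nonneg J) two_ne_zero]
  have h2 : J + star J = 0 ↔ J.re = 0 := by
    rw [add_star, smul_eq_zero, or_iff_left octonion_one_ne_zero]; simp
  simp only [units, Set.mem_ofPred_eq, h1, h2]

lemma neg_mem_units {J : Octonion} (hJ : J ∈ units) : -J ∈ units := by
  rw [mem_units_iff] at *
  simpa [re] using hJ

lemma units_nonempty : units.Nonempty := by
  refine ⟨mk 0 1, ?_⟩
  rw [mem_units_iff]
  refine ⟨by simp [re], ?_⟩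
  rw [← sq_eq_sq₀ (norm_nonneg _) (by positivity), norm_sq_eq]
  simp

lemma unit_mul_cancel {J : Octonion} (hJ : J ∈ units) (x : Octonion) : J * (J * x) = -x := by
  have h := star_mul_cancel J x
  rw [show star J = -J from (neg_eq_of_add_eq_zero_right hJ.1).symm,
    (mem_units_iff.1 hJ).2, neg_mul] at h
  rw [neg_eq_iff_eq_neg] at h
  simpa using h

lemma unit_ne_zero {J : Octonion} (hJ : J ∈ units) : J ≠ 0 := by
  rw [← norm_ne_zero_iff, (mem_units_iff.1 hJ).2]; exact one_ne_zero

/-! ### Slice coordinates -/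

lemma octonion_mul_eq_zero {x y : Octonion} : x * y = 0 ↔ x = 0 ∨ y = 0 := by
  rw [← norm_eq_zero, Octonion.norm_mul, mul_eq_zero, norm_eq_zero, norm_eq_zero]

lemma im_eq (x : Octonion) : x.im = x - x.re • (1 : Octonion) := by
  have h := add_star x
  rw [im, eq_sub_of_add_eq' h, mul_smul, sub_sub_eq_add_sub, ← two_smul ℝ x, ← smul_sub,
    smul_smul]
  norm_num

lemma re_smul_one_add_im (x : Octonion) : x.re • (1 : Octonion) + x.im = x := by
  rw [im_eq]; abel

@[simp] lemma re_add (x y : Octonion) : (x + y).re = x.re + y.re := rfl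
@[simp] lemma re_smul (r : ℝ) (x : Octonion) : (r • x).re = r * x.re := rfl
@[simp] lemma re_one : (1 : Octonion).re = 1 := rfl

@[simp] lemma re_im (x : Octonion) : x.im.re = 0 := by simp [im, re]

lemma re_phi {J : Octonion} (hJ : J ∈ units) (z : ℂ) : (phi J z).re = z.re := by
  simp [phi, (mem_units_iff.1 hJ).1]

lemma im_phi {J : Octonion} (hJ : J ∈ units) (z : ℂ) : (phi J z).im = z.im • J := by
  rw [im_eq, re_phi hJ]; simp [phi]

lemma norm_im_phi {J : Octonion} (hJ : J ∈ units) (z : ℂ) : ‖(phi J z).im‖ = |z.im| := by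
  rw [im_phi hJ, norm_smul, (mem_units_iff.1 hJ).2, mul_one, Real.norm_eq_abs]

lemma star_phi {J : Octonion} (hJ : J ∈ units) (z : ℂ) : star (phi J z) = phi (-J) z := by
  have h := add_star (phi J z)
  rw [eq_sub_of_add_eq' h, re_phi hJ, phi, phi, mul_smul, two_smul]
  rw [smul_neg]; abel

/-- The point of the closed upper half plane that parametrizes the sphere through `x`. -/
def proj (x : Octonion) : ℂ := ⟨x.re, ‖x.im‖⟩

/-- The imaginary direction of `x`. -/
def dir (x : Octonion) : Octonion := ‖x.im‖⁻¹ • x.im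

lemma phi_dir_proj (x : Octonion) : phi (dir x) (proj x) = x := by
  simp only [phi, proj, dir]
  by_cases h : ‖x.im‖ = 0
  -- On the real axis `dir x` is `0`, since `0⁻¹ = 0`; this is harmless because its coefficient
  -- vanishes.
  · have hx := re_smul_one_add_im x
    rw [norm_eq_zero.1 h, add_zero] at hx
    simpa [norm_eq_zero.1 h] using hx
  · rw [smul_smul, mul_inv_cancel₀ h, one_smul, re_smul_one_add_im]

lemma mem_reals_iff {x : Octonion} : x ∈ reals ↔ x.im = 0 := by
  constructor
  · rintro ⟨r, rfl⟩
    simp [im_eq]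
  · intro h
    exact ⟨x.re, by simpa [h] using re_smul_one_add_im x⟩

lemma dir_mem_units {x : Octonion} (hx : x ∉ reals) : dir x ∈ units := by
  rw [mem_reals_iff] at hx
  rw [mem_units_iff, dir, norm_smul, norm_inv, norm_norm, inv_mul_cancel₀ (norm_ne_zero_iff.2 hx)]
  simp

lemma proj_phi {J : Octonion} (hJ : J ∈ units) {z : ℂ} (hz : 0 ≤ z.im) :
    proj (phi J z) = z := by
  apply Complex.ext
  · exact re_phi hJ z
  · exact (norm_im_phi hJ z).trans (abs_of_nonneg hz)

lemma exists_unit_phi_proj (x : Octonion) : ∃ J ∈ units, phi J (proj x) = x := by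
  by_cases hx : x ∈ reals
  · obtain ⟨J, hJ⟩ := units_nonempty
    refine ⟨J, hJ, ?_⟩
    have := re_smul_one_add_im x
    rw [mem_reals_iff.1 hx] at this
    simpa [phi, proj, mem_reals_iff.1 hx] using this
  · exact ⟨dir x, dir_mem_units hx, phi_dir_proj x⟩

lemma phi_conj (J : Octonion) (z : ℂ) : phi J (starRingEnd ℂ z) = phi (-J) z := by
  simp [phi]

/-- Conjugation invariance lets one represent every point of `Ω` over the closed upper half plane,
so questions about `Ω` reduce to questions about `D` through `proj`, whose fibers are the spheres.
-/
lemma mem_circ_iff {D : Set ℂ} (hD : ConjInvariant D) {x : Octonion} :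
    x ∈ circ D ↔ proj x ∈ D := by
  constructor
  · rintro ⟨z, hz, J, hJ, rfl⟩
    rcases le_total 0 z.im with h | h
    · rwa [proj_phi hJ h]
    · rw [← neg_neg J, ← phi_conj, proj_phi (neg_mem_units hJ) (by simpa using h)]
      exact hD z hz
  · intro h
    obtain ⟨J, hJ, hx⟩ := exists_unit_phi_proj x
    exact ⟨_, h, J, hJ, hx.symm⟩

lemma mem_sphere_iff {x y : Octonion} : y ∈ sphere x ↔ proj y = proj x := by
  constructor
  · rintro ⟨I, hI, rfl⟩
    exact proj_phi hI (z := proj x) (norm_nonneg _)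
  · intro h
    obtain ⟨J, hJ, hx⟩ := exists_unit_phi_proj y
    exact ⟨J, hJ, by rw [← hx, h]; rfl⟩

lemma mem_reals_iff_proj {x : Octonion} : x ∈ reals ↔ (proj x).im = 0 := by
  rw [mem_reals_iff]; exact norm_eq_zero.symm

/-! ### Analyticity -/

/-- The product of octonions as a bounded bilinear map. -/
def mulL : Octonion →L[ℝ] Octonion →L[ℝ] Octonion :=
  (LinearMap.mul ℝ Octonion).mkContinuous₂ 1 fun x y => by
    rw [one_mul]; exact (Octonion.norm_mul x y).le

/-- The real part as a bounded linear functional. -/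
def reL : Octonion →L[ℝ] ℝ :=
  LinearMap.toContinuousLinearMap
    { toFun := re, map_add' := fun _ _ => rfl, map_smul' := fun _ _ => rfl }

/-- The conjugation as a bounded linear map. -/
def starL : Octonion →L[ℝ] Octonion :=
  LinearMap.toContinuousLinearMap
    { toFun := star
      map_add' := fun _ _ => by ext <;> simp <;> ring
      map_smul' := fun _ _ => by ext <;> simp }

lemma analyticAt_re (x : Octonion) : AnalyticAt ℝ re x := reL.analyticAt x

lemma analyticAt_im (x : Octonion) : AnalyticAt ℝ im x :=
  AnalyticAt.fun_const_smul (analyticAt_id.fun_sub (starL.analyticAt x))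

lemma analyticAt_norm_sq {E F : Type*} [NormedAddCommGroup E] [NormedSpace ℝ E]
    [NormedAddCommGroup F] [InnerProductSpace ℝ F] {g : E → F} {x : E} (hg : AnalyticAt ℝ g x) :
    AnalyticAt ℝ (fun y => ‖g y‖ ^ 2) x := by
  simp only [← real_inner_self_eq_norm_sq]
  exact (innerSL ℝ).analyticAt_bilinear (g x, g x) |>.comp₂ hg hg

lemma analyticAt_mul {E : Type*} [NormedAddCommGroup E] [NormedSpace ℝ E]
    {g h : E → Octonion} {x : E} (hg : AnalyticAt ℝ g x) (hh : AnalyticAt ℝ h x) :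
    AnalyticAt ℝ (fun y => g y * h y) x :=
  mulL.analyticAt_bilinear (g x, h x) |>.comp₂ hg hh

lemma analyticAt_norm_im {x : Octonion} (hx : x ∉ reals) : AnalyticAt ℝ (fun y => ‖im y‖) x := by
  have h : (fun y => ‖im y‖) = fun y => Real.sqrt (‖im y‖ ^ 2) := by
    ext y; rw [Real.sqrt_sq (norm_nonneg _)]
  rw [h]
  have hx' : ‖im x‖ ^ 2 ≠ 0 := by
    rw [mem_reals_iff] at hx; simpa using hx
  exact AnalyticAt.fun_comp (Real.contDiffAt_sqrt hx').analyticAt (analyticAt_norm_sq (analyticAt_im x))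

lemma analyticAt_proj {x : Octonion} (hx : x ∉ reals) : AnalyticAt ℝ proj x := by
  have h : proj = fun y => Complex.equivRealProdCLM.symm (re y, ‖im y‖) := by
    ext y; apply Complex.ext <;> simp [proj]
  rw [h]
  exact (Complex.equivRealProdCLM.symm.analyticAt _).fun_comp
    ((analyticAt_re x).prod (analyticAt_norm_im hx))

lemma analyticAt_dir {x : Octonion} (hx : x ∉ reals) : AnalyticAt ℝ dir x :=
  ((analyticAt_norm_im hx).inv (norm_ne_zero_iff.2 (mt mem_reals_iff.2 hx))).smul
    (analyticAt_im x)

lemma continuous_proj : Continuous proj := by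
  have h : proj = fun y => Complex.equivRealProdCLM.symm (re y, ‖im y‖) := by
    ext y; apply Complex.ext <;> simp [proj]
  rw [h]
  have h1 : Continuous re := reL.continuous
  have h2 : Continuous im := continuous_iff_continuousAt.2 fun x => (analyticAt_im x).continuousAt
  fun_prop

lemma isOpen_circ {D : Set ℂ} (hD : ConjInvariant D) (ho : IsOpen D) : IsOpen (circ D) := by
  have : circ D = proj ⁻¹' D := by ext x; exact mem_circ_iff hD
  rw [this]; exact ho.preimage continuous_proj

end Octonion

end SliceReg

namespace SliceReg

open Filter Topology Octonion

namespace Octonion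

/-! ### The equation `x + J y = 0` for imaginary units `J` -/

/-- The left quotient `-x y⁻¹`, which solves `x + J y = 0` for `J`. -/
def root (x y : Octonion) : Octonion := -((‖y‖ ^ 2)⁻¹ • (x * star y))

lemma add_root_mul {x y : Octonion} (hy : y ≠ 0) : x + root x y * y = 0 := by
  have hy' : ‖y‖ ^ 2 ≠ 0 := by simpa using hy
  rw [root, neg_mul, smul_mul_assoc, mul_star_cancel, smul_smul, inv_mul_cancel₀ hy', one_smul,
    add_neg_cancel]

lemma root_mem_units {x y : Octonion} (hn : ‖x‖ = ‖y‖) (hi : inner ℝ x y = 0) (hy : y ≠ 0) :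
    root x y ∈ units := by
  have hy' : ‖y‖ ≠ 0 := by simpa using hy
  rw [mem_units_iff]
  constructor
  · rw [root, ← neg_smul, re_smul, re_mul_star, hi, mul_zero]
  · rw [root, norm_neg, norm_smul, Octonion.norm_mul, Octonion.norm_star, hn]
    simp
    field_simp

lemma unit_unique {x y J J' : Octonion} (hy : y ≠ 0) (h : x + J * y = 0) (h' : x + J' * y = 0) :
    J = J' := by
  have : (J - J') * y = 0 := by
    rw [sub_mul, eq_neg_of_add_eq_zero_right h, eq_neg_of_add_eq_zero_right h', sub_self]
  rcases octonion_mul_eq_zero.1 this with h | h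
  · exact sub_eq_zero.1 h
  · exact absurd h hy

/-- Here `x = -J y`; left multiplication by `J` preserves the norm and moves `y` to an orthogonal
vector. -/
lemma isotropic_of_unit {x y J : Octonion} (hJ : J ∈ units) (h : x + J * y = 0) :
    ‖x‖ = ‖y‖ ∧ inner ℝ x y = 0 := by
  rw [mem_units_iff] at hJ
  rw [eq_neg_of_add_eq_zero_left h]
  constructor
  · rw [norm_neg, Octonion.norm_mul, hJ.2, one_mul]
  · rw [inner_neg_left, inner_mul_self, hJ.1]; simp

/-- Since `J (J y) = -y`, the left side is `a (x + J y) + b J (x + J y)`. Hence a complex factor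
does not change the unit attached to `x + ι y`, and zeros can be divided out. -/
lemma unit_complex_smul {x y J : Octonion} (hJ : J ∈ units) (h : x + J * y = 0) (a b : ℝ) :
    (a • x - b • y) + J * (a • y + b • x) = 0 := by
  have hx := eq_neg_of_add_eq_zero_left h
  rw [hx, mul_add, mul_smul_comm, mul_smul_comm, mul_neg, unit_mul_cancel hJ]
  module

lemma analyticAt_root {E : Type*} [NormedAddCommGroup E] [NormedSpace ℝ E]
    {g h : E → Octonion} {x : E} (hg : AnalyticAt ℝ g x) (hh : AnalyticAt ℝ h x) (h0 : h x ≠ 0) :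
    AnalyticAt ℝ (fun y => root (g y) (h y)) x :=
  (((analyticAt_norm_sq hh).inv (by simpa using h0)).smul
    (analyticAt_mul hg ((starL.analyticAt _).fun_comp hh))).neg

/-! ### Complex coordinates on the complexified algebra -/

/-- The number of real coordinates of an octonion. -/
abbrev dim : ℕ := Module.finrank ℝ Octonion

/-- An orthonormal basis of the octonions. -/
def basis : OrthonormalBasis (Fin dim) ℝ Octonion := stdOrthonormalBasis ℝ Octonion

/-- The complex coordinates of `x + ι y`. -/
def coord (x y : Octonion) : Fin dim → ℂ :=
  fun k => ⟨inner ℝ (basis k) x, inner ℝ (basis k) y⟩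

/-- The real part of the element with given complex coordinates. -/
def rePart : (Fin dim → ℂ) →L[ℝ] Octonion :=
  ∑ k, (Complex.reCLM.comp (ContinuousLinearMap.proj k)).smulRight (basis k)

/-- The imaginary part of the element with given complex coordinates. -/
def imPart : (Fin dim → ℂ) →L[ℝ] Octonion :=
  ∑ k, (Complex.imCLM.comp (ContinuousLinearMap.proj k)).smulRight (basis k)

lemma rePart_apply (w : Fin dim → ℂ) : rePart w = ∑ k, (w k).re • basis k := by
  simp [rePart]

lemma imPart_apply (w : Fin dim → ℂ) : imPart w = ∑ k, (w k).im • basis k := by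
  simp [imPart]

lemma rePart_coord (x y : Octonion) : rePart (coord x y) = x := by
  rw [rePart_apply]; exact basis.sum_repr' x

lemma imPart_coord (x y : Octonion) : imPart (coord x y) = y := by
  rw [imPart_apply]; exact basis.sum_repr' y

lemma coord_parts (w : Fin dim → ℂ) : coord (rePart w) (imPart w) = w := by
  ext k
  apply Complex.ext
  · simp only [coord, rePart_apply]
    exact basis.orthonormal.inner_right_fintype _ k
  · simp only [coord, imPart_apply]
    exact basis.orthonormal.inner_right_fintype _ k

lemma rePart_smul (a : ℂ) (w : Fin dim → ℂ) :
    rePart (a • w) = a.re • rePart w - a.im • imPart w := by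
  simp only [rePart_apply, imPart_apply, Finset.smul_sum, ← Finset.sum_sub_distrib]
  refine Finset.sum_congr rfl fun k _ => ?_
  simp [sub_smul, smul_smul]

lemma imPart_smul (a : ℂ) (w : Fin dim → ℂ) :
    imPart (a • w) = a.re • imPart w + a.im • rePart w := by
  simp only [rePart_apply, imPart_apply, Finset.smul_sum, ← Finset.sum_add_distrib]
  refine Finset.sum_congr rfl fun k _ => ?_
  simp [add_smul, smul_smul]

lemma coord_eq_zero {x y : Octonion} : coord x y = 0 ↔ x = 0 ∧ y = 0 := by
  constructor
  · intro h
    exact ⟨by rw [← rePart_coord x y, h, map_zero], by rw [← imPart_coord x y, h, map_zero]⟩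
  · rintro ⟨rfl, rfl⟩
    ext k
    apply Complex.ext <;> simp [coord]

/-- The complex quadratic form that extends the square of the norm. -/
def quad (w : Fin dim → ℂ) : ℂ := ∑ k, w k ^ 2

lemma quad_smul (a : ℂ) (w : Fin dim → ℂ) : quad (a • w) = a ^ 2 * quad w := by
  simp [quad, mul_pow, Finset.mul_sum]

/-- These are the two components of `w wᶜ` for `w = x + ι y`, which links `quad` to the normal
function. -/
lemma quad_coord (x y : Octonion) :
    quad (coord x y) = ⟨‖x‖ ^ 2 - ‖y‖ ^ 2, 2 * inner ℝ x y⟩ := by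
  have h (a b : Octonion) : ∑ k, inner ℝ (basis k) a * inner ℝ (basis k) b = inner ℝ a b := by
    rw [← basis.sum_inner_mul_inner a b]
    exact Finset.sum_congr rfl fun k _ => by rw [real_inner_comm a]
  apply Complex.ext
  · simp only [quad, coord, Complex.re_sum, pow_two, Complex.mul_re, Finset.sum_sub_distrib, h,
      real_inner_self_eq_norm_mul_norm]
  · simp only [quad, coord, Complex.im_sum, pow_two, Complex.mul_im, Finset.sum_add_distrib, h,
      real_inner_comm x y]
    ring

lemma quad_coord_eq_zero {x y : Octonion} :
    quad (coord x y) = 0 ↔ ‖x‖ = ‖y‖ ∧ inner ℝ x y = 0 := by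
  rw [quad_coord, Complex.ext_iff]
  simp only [Complex.zero_re, Complex.zero_im, sub_eq_zero, mul_eq_zero, two_ne_zero, false_or,
    sq_eq_sq₀ (norm_nonneg x) (norm_nonneg y)]

lemma analyticAt_quad (w : Fin dim → ℂ) : AnalyticAt ℂ quad w := by
  unfold quad
  exact Finset.analyticAt_fun_sum _ fun k _ =>
    ((ContinuousLinearMap.proj (R := ℂ) (φ := fun _ : Fin dim => ℂ) k).analyticAt w).pow 2

lemma isotropic_parts {w : Fin dim → ℂ} (h : quad w = 0) (hw : w ≠ 0) :
    ‖rePart w‖ = ‖imPart w‖ ∧ inner ℝ (rePart w) (imPart w) = 0 ∧ imPart w ≠ 0 := by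
  rw [← coord_parts w, quad_coord_eq_zero] at h
  refine ⟨h.1, h.2, fun h0 => hw ?_⟩
  rw [← coord_parts w, coord_eq_zero]
  exact ⟨by simpa [h0] using h.1, h0⟩

/-- A nonzero analytic curve in the null cone of the quadratic form determines a real analytic
curve of imaginary units, also across its zeros. -/
lemma exists_analyticAt_unit {h : ℂ → Fin dim → ℂ} {z₀ : ℂ} (ha : AnalyticAt ℂ h z₀)
    (hne : ¬ ∀ᶠ z in 𝓝 z₀, h z = 0) (hq : ∀ᶠ z in 𝓝 z₀, quad (h z) = 0) :
    ∃ j : ℂ → Octonion, AnalyticAt ℝ j z₀ ∧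
      ∀ᶠ z in 𝓝 z₀, j z ∈ units ∧ rePart (h z) + j z * imPart (h z) = 0 := by
  obtain ⟨n, G, hG, hG0, hhG⟩ := ha.exists_eventuallyEq_pow_smul_nonzero_iff.2 hne
  have hqGa : AnalyticAt ℂ (fun z => quad (G z)) z₀ := (analyticAt_quad _).fun_comp hG
  have hqG : ∀ᶠ z in 𝓝 z₀, quad (G z) = 0 := by
    -- Off `z₀` the factor `(z - z₀)^(2n)` of `quad (h z)` can be cancelled; continuity then gives
    -- the value at `z₀`.
    refine (ContinuousAt.eventuallyEq_nhds_iff_eventuallyEq_nhdsNE hqGa.continuousAt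
      (continuousAt_const (y := (0 : ℂ)))).1 ?_
    filter_upwards [hhG.filter_mono nhdsWithin_le_nhds, hq.filter_mono nhdsWithin_le_nhds,
      self_mem_nhdsWithin] with z h1 h2 h3
    rw [h1, quad_smul] at h2
    exact (mul_eq_zero.1 h2).resolve_left (pow_ne_zero _ (pow_ne_zero _ (sub_ne_zero.2 h3)))
  have hGne : ∀ᶠ z in 𝓝 z₀, G z ≠ 0 := hG.continuousAt.eventually_ne hG0
  have hGr : AnalyticAt ℝ G z₀ := hG.restrictScalars
  refine ⟨fun z => root (rePart (G z)) (imPart (G z)),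
    analyticAt_root ((rePart.analyticAt _).fun_comp hGr) ((imPart.analyticAt _).fun_comp hGr)
      (isotropic_parts hqG.self_of_nhds hG0).2.2, ?_⟩
  filter_upwards [hhG, hqG, hGne] with z h1 h2 h3
  obtain ⟨h4, h5, h6⟩ := isotropic_parts h2 h3
  have hu := root_mem_units h4 h5 h6
  refine ⟨hu, ?_⟩
  rw [h1, rePart_smul, imPart_smul]
  exact unit_complex_smul hu (add_root_mul h6) _ _

end Octonion

/-! ### Zeros of holomorphic functions on slice and product domains -/

/-- This is the identity theorem. On a product domain it reaches only one component, and `hsymm`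
carries the vanishing to the other. -/
lemma eventually_ne_zero_of_exists_ne {E : Type*} [NormedAddCommGroup E] [NormedSpace ℂ E]
    [CompleteSpace E] {D : Set ℂ} (hD : IsSliceDomain D ∨ IsProductDomain D) {g : ℂ → E}
    (hg : AnalyticOnNhd ℂ g D) (hsymm : ∀ z ∈ D, g z = 0 → g (starRingEnd ℂ z) = 0)
    (hne : ¬ ∀ z ∈ D, g z = 0) {z : ℂ} (hz : z ∈ D) : ∀ᶠ w in 𝓝[≠] z, g w ≠ 0 := by
  refine (hg z hz).eventually_eq_zero_or_eventually_ne_zero.resolve_left fun h0 => hne ?_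
  rcases hD with ⟨-, -, hc, -⟩ | ⟨-, -, -, Dp, -, hc, -, rfl⟩
  · exact fun w hw => hg.eqOn_zero_of_preconnected_of_eventuallyEq_zero hc.isPreconnected hz h0 hw
  · rcases hz with hz | hz
    · have h1 : ∀ w ∈ Dp, g w = 0 := fun w hw =>
        (hg.mono Set.subset_union_left).eqOn_zero_of_preconnected_of_eventuallyEq_zero
          hc.isPreconnected hz h0 hw
      rintro w (hw | ⟨w, hw, rfl⟩)
      · exact h1 w hw
      · exact hsymm w (Or.inl hw) (h1 w hw)
    · have h1 : ∀ w ∈ (starRingEnd ℂ) '' Dp, g w = 0 := fun w hw =>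
        (hg.mono Set.subset_union_right).eqOn_zero_of_preconnected_of_eventuallyEq_zero
          (hc.isPreconnected.image _ Complex.continuous_conj.continuousOn) hz h0 hw
      rintro w (hw | hw)
      · have hw' := Set.mem_image_of_mem (starRingEnd ℂ) hw
        simpa using hsymm _ (Or.inr hw') (h1 _ hw')
      · exact h1 w hw

/-! ### Stem functions -/

namespace OctonionC

lemma ext' {w w' : OctonionC} (h₁ : w.fst = w'.fst) (h₂ : w.snd = w'.snd) : w = w' :=
  Prod.ext h₁ h₂

/-- The first component as a bounded linear map. -/
def fstL : OctonionC →L[ℝ] Octonion := ContinuousLinearMap.fst ℝ Octonion Octonion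

/-- The second component as a bounded linear map. -/
def sndL : OctonionC →L[ℝ] Octonion := ContinuousLinearMap.snd ℝ Octonion Octonion

lemma fstL_apply (w : OctonionC) : fstL w = w.fst := rfl
lemma sndL_apply (w : OctonionC) : sndL w = w.snd := rfl

/-- The complex coordinates of an element of the complexified algebra. -/
def coordinates (w : OctonionC) : Fin dim → ℂ := coord w.fst w.snd

end OctonionC

open OctonionC

/-- The components of `∂F/∂α + ι ∂F/∂β = 0` are the Cauchy–Riemann equations for each complex
coordinate. -/
lemma IsHolomorphic.analyticOnNhd {D : Set ℂ} {F : ℂ → OctonionC} (hF : IsHolomorphic D F)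
    (hD : IsOpen D) : AnalyticOnNhd ℂ (fun z => coordinates (F z)) D := by
  refine AnalyticOnNhd.pi fun k => DifferentiableOn.analyticOnNhd (fun z hz => ?_) hD
  have hd : DifferentiableAt ℝ F z :=
    (hF.1.differentiableOn one_ne_zero).differentiableAt (hD.mem_nhds hz)
  let ℓ : Octonion →L[ℝ] ℝ := innerSL ℝ (basis k)
  let L : OctonionC →L[ℝ] ℂ :=
    Complex.equivRealProdCLM.symm.toContinuousLinearMap.comp ((ℓ.comp fstL).prod (ℓ.comp sndL))
  have hL : (fun w => coordinates (F w) k) = fun w => L (F w) := by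
    ext w
    apply Complex.ext <;> rfl
  rw [hL]
  have h0 : fderiv ℝ F z 1 + iota * fderiv ℝ F z Complex.I = 0 := by
    have := hF.2 z hz
    rw [dbar, smul_eq_zero] at this
    exact this.resolve_left (by norm_num)
  set a := fderiv ℝ F z 1
  set b := fderiv ℝ F z Complex.I
  have h1 : a.fst - b.snd = 0 := by
    have h : fstL (a + iota * b) = 0 := by rw [h0]; simp
    rw [map_add, fstL_apply, fstL_apply] at h
    have h' : (iota * b).fst = 0 * b.fst - 1 * b.snd := rfl
    rw [h', zero_mul, Octonion.one_mul, zero_sub, ← sub_eq_add_neg] at h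
    exact h
  have h2 : a.snd + b.fst = 0 := by
    have h : sndL (a + iota * b) = 0 := by rw [h0]; simp
    rw [map_add, sndL_apply, sndL_apply] at h
    have h' : (iota * b).snd = 0 * b.snd + 1 * b.fst := rfl
    rw [h', zero_mul, Octonion.one_mul, zero_add] at h
    exact h
  refine (differentiableAt_complex_iff_differentiableAt_real.2
    ⟨L.differentiableAt.comp z hd, ?_⟩).differentiableWithinAt
  have hfd : fderiv ℝ (L ∘ F) z = L.comp (fderiv ℝ F z) :=
    (L.hasFDerivAt.comp z hd.hasFDerivAt).fderiv
  rw [hfd]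
  -- With `b = ι a`, from `h1` and `h2`, this is the Cauchy–Riemann condition in one coordinate.
  change L b = Complex.I • L a
  have hb1 : b.fst = -a.snd := eq_neg_of_add_eq_zero_right h2
  have hb2 : b.snd = a.fst := (sub_eq_zero.1 h1).symm
  have hLv (w : OctonionC) : L w = ⟨ℓ w.fst, ℓ w.snd⟩ := rfl
  rw [hLv, hLv, hb1, hb2]
  apply Complex.ext <;> simp

lemma coordinates_conj_eq {D : Set ℂ} {F : ℂ → OctonionC} (hF : IsStem D F) {z : ℂ} (hz : z ∈ D) :
    coordinates (F (starRingEnd ℂ z)) = coord (F z).fst (-(F z).snd) := by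
  rw [hF z hz]; rfl

lemma IsStem.snd_eq_zero {D : Set ℂ} {F : ℂ → OctonionC} (hF : IsStem D F) {z : ℂ} (hz : z ∈ D)
    (him : z.im = 0) : (F z).snd = 0 := by
  have h := hF z hz
  rw [Complex.conj_eq_iff_im.2 him] at h
  have h' : (F z).snd = -(F z).snd := congrArg OctonionC.snd h
  have h2 : (2 : ℝ) • (F z).snd = 0 := by
    rw [two_smul]; nth_rewrite 1 [h']; exact neg_add_cancel _
  exact (smul_eq_zero.1 h2).resolve_left two_ne_zero

lemma IsStem.coordinates_conj {D : Set ℂ} {F : ℂ → OctonionC} (hF : IsStem D F) {z : ℂ}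
    (hz : z ∈ D) (h : coordinates (F z) = 0) : coordinates (F (starRingEnd ℂ z)) = 0 := by
  rw [coordinates_conj_eq hF hz]
  rw [coordinates, coord_eq_zero] at h
  rw [coord_eq_zero, neg_eq_zero]
  exact h

lemma IsStem.quad_conj {D : Set ℂ} {F : ℂ → OctonionC} (hF : IsStem D F) {z : ℂ}
    (hz : z ∈ D) (h : quad (coordinates (F z)) = 0) :
    quad (coordinates (F (starRingEnd ℂ z))) = 0 := by
  rw [coordinates_conj_eq hF hz]
  rw [coordinates, quad_coord_eq_zero] at h
  rw [quad_coord_eq_zero, norm_neg, inner_neg_right, neg_eq_zero]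
  exact h

/-- The sum of the values at `J` and `-J` determines the first component, and then `J`, not being a
zero divisor, determines the second. -/
lemma stem_unique {D : Set ℂ} {F G : ℂ → OctonionC} {f : Octonion → Octonion}
    (hF : Induces D F f) (hG : Induces D G f) {z : ℂ} (hz : z ∈ D) : F z = G z := by
  obtain ⟨J, hJ⟩ := units_nonempty
  have h1 : (F z).fst + J * (F z).snd = (G z).fst + J * (G z).snd :=
    (hF J hJ z hz).symm.trans (hG J hJ z hz)
  have h2 : (F z).fst + (-J) * (F z).snd = (G z).fst + (-J) * (G z).snd :=
    (hF (-J) (neg_mem_units hJ) z hz).symm.trans (hG (-J) (neg_mem_units hJ) z hz)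
  rw [neg_mul, neg_mul] at h2
  have h3 : (F z).fst = (G z).fst := by
    have : (2 : ℝ) • (F z).fst = (2 : ℝ) • (G z).fst := by
      rw [two_smul, two_smul]
      calc (F z).fst + (F z).fst = ((F z).fst + J * (F z).snd) + ((F z).fst + -(J * (F z).snd)) := by
            abel
        _ = (G z).fst + (G z).fst := by rw [h1, h2]; abel
    exact smul_right_injective _ (two_ne_zero (α := ℝ)) this
  rw [h3, add_right_inj, ← sub_eq_zero, ← mul_sub, octonion_mul_eq_zero] at h1
  exact ext' h3 (sub_eq_zero.1 (h1.resolve_left (unit_ne_zero hJ)))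

/-! ### The normal function in terms of the complex quadratic form -/

lemma stemOf_eq {D : Set ℂ} {F : ℂ → OctonionC} {f : Octonion → Octonion} (hs : IsStem D F)
    (hF : Induces D F f) {z : ℂ} (hz : z ∈ D) : stemOf D f z = F z :=
  stem_unique (Classical.epsilon_spec (p := fun F => IsStem D F ∧ Induces D F f)
    ⟨F, hs, hF⟩).2 hF hz

lemma normalFun_eq_zero_iff {D : Set ℂ} (hD : ConjInvariant D) {F : ℂ → OctonionC}
    {f : Octonion → Octonion} (hs : IsStem D F) (hF : Induces D F f) {x : Octonion}
    (hx : x ∈ circ D) : normalFun D f x = 0 ↔ quad (coordinates (F (proj x))) = 0 := by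
  have hz := (mem_circ_iff hD).1 hx
  have h1 : normalFun D f x =
      OctonionC.phi (dir x) (F (proj x) * star (F (proj x))) := by
    rw [← stemOf_eq hs hF hz]; rfl
  set a := (F (proj x)).fst with ha
  set b := (F (proj x)).snd with hb
  have h2 : normalFun D f x =
      (‖a‖ ^ 2 - ‖b‖ ^ 2) • (1 : Octonion) + dir x * ((2 * inner ℝ a b) • (1 : Octonion)) := by
    rw [h1, ← mul_star_add_mul_star, sub_smul, ← mul_star_self, ← mul_star_self]
    rfl
  rw [coordinates, ← ha, ← hb, quad_coord_eq_zero]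
  constructor
  · intro h
    rw [h2] at h
    have hab : inner ℝ a b = 0 := by
      -- At real points `dir x` is not a unit, but there `b = 0`.
      by_cases hr : x ∈ reals
      · have : b = 0 := hs.snd_eq_zero hz (mem_reals_iff_proj.1 hr)
        rw [this, inner_zero_right]
      · have hJ := dir_mem_units hr
        -- Both components are real multiples of `1`, so orthogonality makes one of them zero and
        -- equality of norms makes the other zero.
        have hi := isotropic_of_unit hJ h
        simp only [inner_smul_left, inner_smul_right, norm_smul, Octonion.norm_one,
          real_inner_self_eq_norm_sq] at hi
        simp at hi
        rcases hi.2 with h3 | h3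
        · exact h3
        · simpa [h3] using hi.1.symm
    refine ⟨?_, hab⟩
    rw [hab] at h
    simp only [mul_zero, zero_smul, add_zero, smul_eq_zero, octonion_one_ne_zero, or_false] at h
    rwa [sub_eq_zero, sq_eq_sq₀ (norm_nonneg _) (norm_nonneg _)] at h
  · rintro ⟨h3, h4⟩
    rw [h2, h3, h4]
    simp

lemma normalFun_eq_zero_forall_iff {D : Set ℂ} (hD : ConjInvariant D) {F : ℂ → OctonionC}
    {f : Octonion → Octonion} (hs : IsStem D F) (hF : Induces D F f) :
    (∀ x ∈ circ D, normalFun D f x = 0) ↔ ∀ z ∈ D, quad (coordinates (F z)) = 0 := by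
  constructor
  · intro h z hz
    obtain ⟨J, hJ⟩ := units_nonempty
    have key : ∀ z ∈ D, 0 ≤ z.im → quad (coordinates (F z)) = 0 := fun z hz hz0 => by
      have hx : Octonion.phi J z ∈ circ D := ⟨z, hz, J, hJ, rfl⟩
      rw [← proj_phi hJ hz0]
      exact (normalFun_eq_zero_iff hD hs hF hx).1 (h _ hx)
    rcases le_total 0 z.im with h0 | h0
    · exact key z hz h0
    · simpa using hs.quad_conj (hD z hz) (key _ (hD z hz) (by simpa using h0))
  · intro h x hx
    exact (normalFun_eq_zero_iff hD hs hF hx).2 (h _ ((mem_circ_iff hD).1 hx))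

end SliceReg

namespace SliceReg

open Filter Topology Octonion OctonionC

/-! ### Fibers of slice functions -/

section Fiber

variable {D : Set ℂ} {F : ℂ → OctonionC} {f : Octonion → Octonion}

lemma Induces.apply_eq (hF : Induces D F f) {x : Octonion} (hx : proj x ∈ D) :
    ∃ J ∈ units, Octonion.phi J (proj x) = x ∧ f x = (F (proj x)).fst + J * (F (proj x)).snd := by
  obtain ⟨J, hJ, h⟩ := exists_unit_phi_proj x
  refine ⟨J, hJ, h, ?_⟩
  have := hF J hJ _ hx
  rwa [h] at this

lemma quad_eq_zero_of_mem_fiber (hD : ConjInvariant D) (hF : Induces D F f) {x : Octonion}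
    (hx : x ∈ fiber (circ D) f 0) : quad (coordinates (F (proj x))) = 0 := by
  obtain ⟨J, hJ, -, h⟩ := hF.apply_eq ((mem_circ_iff hD).1 hx.1)
  rw [hx.2] at h
  exact quad_coord_eq_zero.2 (isotropic_of_unit hJ h.symm)

lemma coordinates_eq_zero_of_mem_fiber (hD : ConjInvariant D) (hF : Induces D F f) {x : Octonion}
    (hx : x ∈ fiber (circ D) f 0) (h0 : (F (proj x)).snd = 0) : coordinates (F (proj x)) = 0 := by
  obtain ⟨J, hJ, -, h⟩ := hF.apply_eq ((mem_circ_iff hD).1 hx.1)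
  rw [hx.2, h0, mul_zero, add_zero] at h
  exact coord_eq_zero.2 ⟨h.symm, h0⟩

/-- On a sphere `f` has the form `x + J y` with `x, y` fixed, and for `y ≠ 0` at most one `J` gives
zero. -/
lemma fiber_eq_of_proj_eq (hD : ConjInvariant D) (hF : Induces D F f) {x y : Octonion}
    (hx : x ∈ fiber (circ D) f 0) (hy : y ∈ fiber (circ D) f 0) (hxy : proj y = proj x)
    (h0 : (F (proj x)).snd ≠ 0) : y = x := by
  obtain ⟨J, hJ, h1, h⟩ := hF.apply_eq ((mem_circ_iff hD).1 hx.1)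
  obtain ⟨J', hJ', h1', h'⟩ := hF.apply_eq ((mem_circ_iff hD).1 hy.1)
  rw [hx.2] at h
  rw [hy.2, hxy] at h'
  rw [← h1, ← h1', hxy, unit_unique h0 h.symm h'.symm]

lemma eq_of_proj_eq_of_mem_reals {x y : Octonion} (hx : x ∈ reals) (hxy : proj y = proj x) :
    y = x := by
  have h := mem_reals_iff_proj.1 hx
  rw [← phi_dir_proj x, ← phi_dir_proj y, hxy, Octonion.phi, Octonion.phi, h, zero_smul, zero_smul]

lemma mem_fiber_of_proj_eq (hD : ConjInvariant D) (hF : Induces D F f) {x y : Octonion}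
    (hx : x ∈ fiber (circ D) f 0) (hxy : proj y = proj x) (h0 : (F (proj x)).snd = 0) :
    y ∈ fiber (circ D) f 0 := by
  have hz := (mem_circ_iff hD).1 hx.1
  have hy : y ∈ circ D := (mem_circ_iff hD).2 (hxy ▸ hz)
  obtain ⟨J, hJ, h1, h⟩ := hF.apply_eq hz
  obtain ⟨J', hJ', h1', h'⟩ := hF.apply_eq (hxy.symm ▸ hz)
  refine ⟨hy, ?_⟩
  rw [hx.2, h0, mul_zero] at h
  rw [h', hxy, h0, mul_zero]
  exact h.symm

/-- Otherwise the solution `J` would be unique, while both `J` and `-J` are solutions. -/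
lemma snd_eq_zero_of_sphere_subset (hF : Induces D F f) (hD : ConjInvariant D) {x : Octonion}
    (hx : sphere x ⊆ fiber (circ D) f 0) : (F (proj x)).snd = 0 := by
  by_contra h0
  have hxm : x ∈ sphere x := mem_sphere_iff.2 rfl
  have hpos : 0 ≤ (proj x).im := norm_nonneg _
  have hm : ∀ J ∈ units, (F (proj x)).fst + J * (F (proj x)).snd = 0 := fun J hJ => by
    have h1 := (hx (mem_sphere_iff.2 (proj_phi hJ hpos))).2
    rwa [hF J hJ _ ((mem_circ_iff hD).1 (hx hxm).1)] at h1
  obtain ⟨J, hJ⟩ := units_nonempty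
  have h := unit_unique h0 (hm J hJ) (hm (-J) (neg_mem_units hJ))
  have h2 : (2 : ℝ) • J = 0 := by
    rw [two_smul]; nth_rewrite 1 [h]; exact neg_add_cancel _
  exact unit_ne_zero hJ ((smul_eq_zero.1 h2).resolve_left two_ne_zero)

/-- The difference `f(x) - f(xᶜ)` is `2 J y`, and neither `J` nor `Im(x)⁻¹` is a zero divisor. -/
lemma mem_degenerateSet_iff (hD : ConjInvariant D) (hF : Induces D F f) {x : Octonion} :
    x ∈ degenerateSet (circ D) f ↔ x ∈ circ D \ reals ∧ (F (proj x)).snd = 0 := by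
  refine and_congr_right fun hx => ?_
  have hz := (mem_circ_iff hD).1 hx.1
  obtain ⟨J, hJ, h1, h⟩ := hF.apply_eq hz
  have h2 : star x = Octonion.phi (-J) (proj x) := by rw [← star_phi hJ, h1]
  have h3 : f x - f (star x) = (2 : ℝ) • (J * (F (proj x)).snd) := by
    rw [h, h2, hF (-J) (neg_mem_units hJ) _ hz, OctonionC.phi, neg_mul, two_smul]
    abel
  have him : x.im ≠ 0 := mt mem_reals_iff.2 hx.2
  have hinv : (x.im)⁻¹ ≠ 0 := by
    change (‖x.im‖ ^ 2)⁻¹ • star x.im ≠ 0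
    rw [smul_ne_zero_iff]
    exact ⟨by simpa using him, by
      rw [← norm_ne_zero_iff, Octonion.norm_star]; simpa using him⟩
  rw [sphDeriv, h3, mul_smul_comm, smul_smul, smul_eq_zero, octonion_mul_eq_zero,
    octonion_mul_eq_zero]
  simp [hinv, unit_ne_zero hJ]

/-- Pulling back a neighbourhood along `proj` turns an isolated point of `D` into an isolated
sphere. -/
lemma exists_isOpen_proj {p : ℂ → Prop} {x : Octonion} (h : ∀ᶠ w in 𝓝[≠] proj x, ¬ p w) :
    ∃ U : Set Octonion, IsOpen U ∧ (∀ y, proj y = proj x → y ∈ U) ∧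
      ∀ y ∈ U, p (proj y) → proj y = proj x := by
  rw [eventually_nhdsWithin_iff] at h
  obtain ⟨V, hV, hVo, hxV⟩ := eventually_nhds_iff.1 h
  refine ⟨proj ⁻¹' V, hVo.preimage continuous_proj, fun y hy => ?_, fun y hy hp => ?_⟩
  · rw [Set.mem_preimage, hy]; exact hxV
  · by_contra hne
    exact hV _ hy hne hp

lemma fiber_isolated (hD : ConjInvariant D) (hF : Induces D F f)
    (hiso : ∀ z ∈ D, ∀ᶠ w in 𝓝[≠] z, quad (coordinates (F w)) ≠ 0) {x : Octonion}
    (hx : x ∈ fiber (circ D) f 0) :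
    ((F (proj x)).snd ≠ 0 ∨ x ∈ reals → IsIsolatedIn {x} (fiber (circ D) f 0)) ∧
      ((F (proj x)).snd = 0 → IsIsolatedIn (sphere x) (fiber (circ D) f 0)) := by
  obtain ⟨U, hU, hU1, hU2⟩ := exists_isOpen_proj (hiso _ ((mem_circ_iff hD).1 hx.1))
  have key : ∀ y ∈ fiber (circ D) f 0 ∩ U, proj y = proj x := fun y hy =>
    hU2 y hy.2 (quad_eq_zero_of_mem_fiber hD hF hy.1)
  constructor
  · intro h
    refine ⟨U, hU, Set.Subset.antisymm (fun y hy => ?_) ?_⟩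
    · rcases h with h | h
      · exact fiber_eq_of_proj_eq hD hF hx hy.1 (key y hy) h
      · exact eq_of_proj_eq_of_mem_reals h (key y hy)
    · rintro _ rfl
      exact ⟨hx, hU1 _ rfl⟩
  · intro h
    refine ⟨U, hU, Set.Subset.antisymm (fun y hy => mem_sphere_iff.2 (key y hy)) fun y hy => ?_⟩
    rw [mem_sphere_iff] at hy
    exact ⟨mem_fiber_of_proj_eq hD hF hx hy h, hU1 _ hy⟩

/-- At a degenerate point of the fiber both stem components vanish, so isolated zeros of `F`
suffice; this is why it also applies when `quad` vanishes identically. -/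
lemma degenerate_fiber_isolated (hD : ConjInvariant D) (hF : Induces D F f)
    (hiso : ∀ z ∈ D, ∀ᶠ w in 𝓝[≠] z, coordinates (F w) ≠ 0) {x : Octonion}
    (hx : x ∈ fiber (circ D) f 0 ∩ degenerateSet (circ D) f) :
    IsIsolatedIn (sphere x) (fiber (circ D) f 0 ∩ degenerateSet (circ D) f) := by
  obtain ⟨U, hU, hU1, hU2⟩ := exists_isOpen_proj (hiso _ ((mem_circ_iff hD).1 hx.1.1))
  obtain ⟨hx1, hx2⟩ := hx
  rw [mem_degenerateSet_iff hD hF] at hx2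
  refine ⟨U, hU, Set.Subset.antisymm (fun y hy => ?_) fun y hy => ?_⟩
  · refine mem_sphere_iff.2 (hU2 y hy.2 (coordinates_eq_zero_of_mem_fiber hD hF hy.1.1 ?_))
    exact ((mem_degenerateSet_iff hD hF).1 hy.1.2).2
  · rw [mem_sphere_iff] at hy
    have hyf := mem_fiber_of_proj_eq hD hF hx1 hy hx2.2
    refine ⟨⟨hyf, (mem_degenerateSet_iff hD hF).2 ⟨⟨hyf.1, ?_⟩, by rw [hy]; exact hx2.2⟩⟩, hU1 _ hy⟩
    rw [mem_reals_iff_proj, hy, ← mem_reals_iff_proj]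
    exact hx2.1.2

lemma sUnion_isolated_spheres (hD : ConjInvariant D) (hF : Induces D F f)
    (hiso : ∀ z ∈ D, ∀ᶠ w in 𝓝[≠] z, quad (coordinates (F w)) ≠ 0) :
    ⋃₀ {S : Set Octonion | ∃ x₀ ∈ circ D \ reals, S = sphere x₀ ∧
      IsIsolatedIn S (fiber (circ D) f 0)} =
        fiber (circ D) f 0 ∩ degenerateSet (circ D) f := by
  apply Set.Subset.antisymm
  · rintro x ⟨_, ⟨x₀, hx₀, rfl, U, -, hU⟩, hx⟩
    have hsub : sphere x₀ ⊆ fiber (circ D) f 0 := by rw [← hU]; exact Set.inter_subset_left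
    have h0 := snd_eq_zero_of_sphere_subset hF hD hsub
    have hxf := hsub hx
    rw [mem_sphere_iff] at hx
    refine ⟨hxf, (mem_degenerateSet_iff hD hF).2 ⟨⟨hxf.1, ?_⟩, by rwa [hx]⟩⟩
    rw [mem_reals_iff_proj, hx, ← mem_reals_iff_proj]
    exact hx₀.2
  · rintro x ⟨hx, hd⟩
    rw [mem_degenerateSet_iff hD hF] at hd
    exact ⟨sphere x, ⟨x, hd.1, rfl, (fiber_isolated hD hF hiso hx).2 hd.2⟩,
      mem_sphere_iff.2 rfl⟩

end Fiber

/-! ### The surface in a fiber on which the normal function vanishes -/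

section Surface

variable {D : Set ℂ} {J : ℂ → Octonion}

/-- The section `z ↦ α + β J(z)` of `proj` over the upper half plane. -/
def unitSection (J : ℂ → Octonion) (z : ℂ) : Octonion := Octonion.phi (J z) z

lemma analyticAt_unitSection {z : ℂ} (hJ : AnalyticAt ℝ J z) :
    AnalyticAt ℝ (unitSection J) z :=
  ((Complex.reCLM.analyticAt z).smul analyticAt_const).add ((Complex.imCLM.analyticAt z).smul hJ)

lemma proj_unitSection (hJ : ∀ z ∈ D, J z ∈ units) {z : ℂ} (hz : z ∈ D) (h0 : 0 ≤ z.im) :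
    proj (unitSection J z) = z := proj_phi (hJ z hz) h0

/-- By the chain rule, the differential of `proj` is a left inverse. -/
lemma injective_fderiv_unitSection {V : Set ℂ} (hV : IsOpen V) (hpos : ∀ z ∈ V, 0 < z.im)
    (hJ : ∀ z ∈ V, J z ∈ units) (hJa : AnalyticOnNhd ℝ J V) {z : ℂ} (hz : z ∈ V) :
    Function.Injective (fderiv ℝ (unitSection J) z) := by
  have h1 := (analyticAt_unitSection (hJa z hz)).differentiableAt.hasFDerivAt
  have hr : unitSection J z ∉ reals := by
    rw [mem_reals_iff_proj, proj_unitSection hJ hz (hpos z hz).le]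
    exact (hpos z hz).ne'
  have h2 := (analyticAt_proj hr).differentiableAt.hasFDerivAt.comp z h1
  have h3 : proj ∘ unitSection J =ᶠ[𝓝 z] id := by
    filter_upwards [hV.mem_nhds hz] with w hw
    exact proj_unitSection hJ hw (hpos w hw).le
  have h4 := h2.unique ((hasFDerivAt_id z).congr_of_eventuallyEq h3)
  refine Function.LeftInverse.injective (g := fderiv ℝ proj (unitSection J z)) fun v => ?_
  exact DFunLike.congr_fun h4 v

/-- One global chart suffices: `proj` is a continuous left inverse, so the section is an embedding.
-/
lemma isRealAnalyticSurface_image {V : Set ℂ} (hne : V.Nonempty) (hV : IsOpen V)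
    (hpos : ∀ z ∈ V, 0 < z.im) (hJ : ∀ z ∈ V, J z ∈ units) (hJa : AnalyticOnNhd ℝ J V) :
    IsRealAnalyticSurface (unitSection J '' V) := by
  refine ⟨hne.image _, fun x _ => ⟨Set.univ, V, unitSection J, isOpen_univ, Set.mem_univ _, hV,
    fun z hz => analyticAt_unitSection (hJa z hz),
    fun z hz => injective_fderiv_unitSection hV hpos hJ hJa hz, ?_, (Set.inter_univ _).symm⟩⟩
  have hc : ContinuousOn (unitSection J) V := fun z hz =>
    (analyticAt_unitSection (hJa z hz)).continuousAt.continuousWithinAt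
  refine Topology.IsEmbedding.of_comp hc.domRestrict continuous_proj ?_
  have : proj ∘ V.domRestrict (unitSection J) = Subtype.val := by
    ext1 z
    exact proj_unitSection hJ z.2 (hpos z z.2).le
  rw [this]
  exact Topology.IsEmbedding.subtypeVal

lemma mem_image_unitSection_iff {V : Set ℂ} (hpos : ∀ z ∈ V, 0 < z.im)
    (hJ : ∀ z ∈ V, J z ∈ units) {x : Octonion} (hx : proj x ∈ V) :
    x ∈ unitSection J '' V ↔ unitSection J (proj x) = x := by
  constructor
  · rintro ⟨z, hz, rfl⟩
    rw [proj_unitSection hJ hz (hpos z hz).le]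
  · exact fun h => ⟨_, hx, h⟩

/-- The image is where `unitSection J ∘ proj` fixes `x`. The equation is analytic on `Ω` because `Ω`
misses the real axis, where `proj` may fail to be smooth. -/
lemma isRealAnalyticSubset_image {Ω : Set Octonion} {V : Set ℂ} (hpos : ∀ z ∈ V, 0 < z.im)
    (hJ : ∀ z ∈ V, J z ∈ units) (hJa : AnalyticOnNhd ℝ J V) (hΩ : ∀ x, x ∈ Ω ↔ proj x ∈ V) :
    IsRealAnalyticSubset Ω (unitSection J '' V) := by
  refine ⟨fun x => ‖unitSection J (proj x) - x‖ ^ 2, fun x hx => ?_, ?_⟩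
  · have hx' := (hΩ x).1 hx
    have hr : x ∉ reals := by
      rw [mem_reals_iff_proj]; exact (hpos _ hx').ne'
    exact analyticAt_norm_sq
      (((analyticAt_unitSection (hJa _ hx')).fun_comp (analyticAt_proj hr)).fun_sub analyticAt_id)
  · ext x
    have h : ‖unitSection J (proj x) - x‖ ^ 2 = 0 ↔ unitSection J (proj x) = x := by
      rw [sq_eq_zero_iff, norm_eq_zero, sub_eq_zero]
    constructor
    · intro hx
      have hxV : proj x ∈ V := by
        obtain ⟨z, hz, rfl⟩ := hx
        rwa [proj_unitSection hJ hz (hpos z hz).le]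
      exact ⟨(hΩ x).2 hxV, h.2 ((mem_image_unitSection_iff hpos hJ hxV).1 hx)⟩
    · rintro ⟨hx, hx0⟩
      exact (mem_image_unitSection_iff hpos hJ ((hΩ x).1 hx)).2 (h.1 hx0)

/-- A differentiable function that is constant along an immersed curve or surface has a singular
differential there. -/
lemma not_bijective_of_eventually_const {E G H : Type*} [NormedAddCommGroup E] [NormedSpace ℝ E]
    [NormedAddCommGroup G] [NormedSpace ℝ G] [NormedAddCommGroup H] [NormedSpace ℝ H]
    [Nontrivial E] {σ : E → G} {f : G → H} {z : E} {L : G →L[ℝ] H} {c : H}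
    (hL : HasFDerivAt f L (σ z)) (hσ : DifferentiableAt ℝ σ z)
    (hi : Function.Injective (fderiv ℝ σ z)) (hc : ∀ᶠ w in 𝓝 z, f (σ w) = c) :
    ¬ Function.Bijective L := by
  intro hb
  have h2 := (hL.comp z hσ.hasFDerivAt).unique ((hasFDerivAt_const c z).congr_of_eventuallyEq hc)
  obtain ⟨v, hv⟩ := exists_ne (0 : E)
  have h3 : L (fderiv ℝ σ z v) = 0 := DFunLike.congr_fun h2 v
  rw [← map_zero L] at h3
  have h4 := hb.1 h3
  rw [← map_zero (fderiv ℝ σ z)] at h4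
  exact hv (hi h4)

end Surface

/-! ### Analyticity of the function and of the field of units -/

/-- Off the real axis `f = F₁ ∘ proj + dir · (F₂ ∘ proj)`, with every ingredient analytic. -/
lemma Induces.analyticAt {D : Set ℂ} {F : ℂ → OctonionC} {f : Octonion → Octonion}
    (hD : ConjInvariant D) (ho : IsOpen D) (hF : Induces D F f) (hh : IsHolomorphic D F)
    {x : Octonion} (hx : x ∈ circ D) (hr : x ∉ reals) : AnalyticAt ℝ f x := by
  have hz := (mem_circ_iff hD).1 hx
  have ha : AnalyticAt ℝ (fun z => coordinates (F z)) (proj x) :=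
    (hh.analyticOnNhd ho _ hz).restrictScalars
  have ha' := ha.fun_comp (analyticAt_proj hr)
  have h1 : AnalyticAt ℝ (fun y => (F (proj y)).fst) x := by
    have := (rePart.analyticAt _).fun_comp ha'
    simpa only [coordinates, rePart_coord] using this
  have h2 : AnalyticAt ℝ (fun y => (F (proj y)).snd) x := by
    have := (imPart.analyticAt _).fun_comp ha'
    simpa only [coordinates, imPart_coord] using this
  refine (h1.fun_add (analyticAt_mul (analyticAt_dir hr) h2)).congr ?_
  have hopen : ∀ᶠ y in 𝓝 x, y ∈ circ D := (isOpen_circ hD ho).mem_nhds hx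
  have hne : ∀ᶠ y in 𝓝 x, im y ≠ 0 :=
    (analyticAt_im x).continuousAt.eventually_ne (mt mem_reals_iff.2 hr)
  filter_upwards [hopen, hne] with y hy hy'
  have := hF (dir y) (dir_mem_units (mt mem_reals_iff.1 hy')) _ ((mem_circ_iff hD).1 hy)
  rw [phi_dir_proj] at this
  exact this.symm

lemma exists_analyticOnNhd_unit {D : Set ℂ} (ho : IsOpen D) {h : ℂ → Fin dim → ℂ}
    (ha : AnalyticOnNhd ℂ h D) (hiso : ∀ z ∈ D, ∀ᶠ w in 𝓝[≠] z, h w ≠ 0)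
    (hq : ∀ z ∈ D, quad (h z) = 0) :
    ∃ J : ℂ → Octonion, AnalyticOnNhd ℝ J D ∧
      ∀ z ∈ D, J z ∈ units ∧ rePart (h z) + J z * imPart (h z) = 0 := by
  have key : ∀ z ∈ D, ∃ j : ℂ → Octonion, AnalyticAt ℝ j z ∧
      ∀ᶠ w in 𝓝 z, j w ∈ units ∧ rePart (h w) + j w * imPart (h w) = 0 := fun z hz =>
    exists_analyticAt_unit (ha z hz)
      (fun h0 => ((hiso z hz).and (h0.filter_mono nhdsWithin_le_nhds)).exists.elim
        fun w hw => hw.1 hw.2)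
      (Filter.mem_of_superset (ho.mem_nhds hz) hq)
  choose! j hja hj using key
  -- Each local field is evaluated at its own centre. Near `z` the result agrees with `j z`: away
  -- from `z` one has `h ≠ 0`, so the unit is unique.
  refine ⟨fun z => j z z, fun z hz => (hja z hz).congr ?_, fun z hz => (hj z hz).self_of_nhds⟩
  have hne := hiso z hz
  rw [eventually_nhdsWithin_iff] at hne
  have hzD : ∀ᶠ w in 𝓝 z, w ∈ D := ho.mem_nhds hz
  filter_upwards [hne, hj z hz, hzD] with w h1 h2 h3
  by_cases hwz : w = z
  · rw [hwz]
  · exact unit_unique (isotropic_parts (hq w h3) (h1 hwz)).2.2 h2.2 (hj w h3).self_of_nhds.2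

end SliceReg

namespace SliceReg

open Filter Topology Octonion OctonionC

/-! ### The fiber theorem for a general value -/

/-- The stem function of `f - c`, if `F` is that of `f`. -/
def subStem (F : ℂ → OctonionC) (c : Octonion) (z : ℂ) : OctonionC := F z - OctonionC.mk c 0

section SubConst

variable {D : Set ℂ} {F : ℂ → OctonionC} {f : Octonion → Octonion}

lemma fst_subStem (F : ℂ → OctonionC) (c : Octonion) (z : ℂ) :
    (subStem F c z).fst = (F z).fst - c := rfl

lemma snd_subStem (F : ℂ → OctonionC) (c : Octonion) (z : ℂ) :
    (subStem F c z).snd = (F z).snd := sub_zero (F z).snd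

lemma IsStem.subStem (hs : IsStem D F) (c : Octonion) : IsStem D (subStem F c) := fun z hz => by
  refine ext' ?_ ?_
  · rw [fst_subStem, hs z hz]; rfl
  · rw [snd_subStem, hs z hz]
    change -(F z).snd = -(SliceReg.subStem F c z).snd
    rw [snd_subStem]

lemma IsHolomorphic.subStem (hh : IsHolomorphic D F) (c : Octonion) :
    IsHolomorphic D (subStem F c) := by
  refine ⟨hh.1.sub contDiffOn_const, fun z hz => ?_⟩
  have h : fderiv ℝ (SliceReg.subStem F c) z = fderiv ℝ F z := fderiv_sub_const _
  rw [dbar, h]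
  exact hh.2 z hz

lemma Induces.subStem (hF : Induces D F f) (c : Octonion) :
    Induces D (subStem F c) (fun x => f x - c) := fun J hJ z hz => by
  change f (Octonion.phi J z) - c = _
  rw [OctonionC.phi, fst_subStem, snd_subStem, hF J hJ z hz, OctonionC.phi]
  abel

lemma fiber_sub_const (Ω : Set Octonion) (f : Octonion → Octonion) (c : Octonion) :
    fiber Ω (fun x => f x - c) 0 = fiber Ω f c := by
  ext x
  exact and_congr_right fun _ => sub_eq_zero

lemma degenerateSet_sub_const (Ω : Set Octonion) (f : Octonion → Octonion) (c : Octonion) :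
    degenerateSet Ω (fun x => f x - c) = degenerateSet Ω f := by
  simp only [degenerateSet, sphDeriv, sub_sub_sub_cancel_right]

/-- A nonconstant slice regular function minus a constant has a stem function that is not
identically zero. -/
lemma Induces.exists_coordinates_ne_zero (hF : Induces D F f)
    (hnc : ¬ ∃ a : Octonion, ∀ x ∈ circ D, f x = a) (c : Octonion) :
    ¬ ∀ z ∈ D, coordinates (SliceReg.subStem F c z) = 0 := by
  intro h
  refine hnc ⟨c, ?_⟩
  rintro _ ⟨z, hz, J, hJ, rfl⟩
  obtain ⟨h1, h2⟩ := coord_eq_zero.1 (h z hz)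
  have h3 := hF.subStem c J hJ z hz
  rw [OctonionC.phi, h1, h2, mul_zero, add_zero] at h3
  exact sub_eq_zero.1 h3

end SubConst

/-- On a slice domain the complex norm of a nonzero holomorphic stem function is not identically
zero. -/
lemma IsSliceDomain.exists_quad_ne_zero {D : Set ℂ} (hD : IsSliceDomain D) {F : ℂ → OctonionC}
    (hs : IsStem D F) (hh : IsHolomorphic D F) (hne : ¬ ∀ z ∈ D, coordinates (F z) = 0) :
    ¬ ∀ z ∈ D, quad (coordinates (F z)) = 0 := by
  intro hq
  obtain ⟨r, hr⟩ := hD.2.2.2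
  -- At real points the second component vanishes, and isotropy then forces the first to vanish.
  have hreal : ∀ t : ℝ, (t : ℂ) ∈ D → coordinates (F t) = 0 := fun t ht => by
    have h1 := hs.snd_eq_zero ht (Complex.ofReal_im t)
    have h2 := (quad_coord_eq_zero.1 (hq t ht)).1
    rw [h1, norm_zero, norm_eq_zero] at h2
    exact coord_eq_zero.2 ⟨h2, h1⟩
  have hiso := eventually_ne_zero_of_exists_ne (Or.inl hD) (hh.analyticOnNhd hD.1)
    (fun z hz => hs.coordinates_conj hz) hne hr
  rw [eventually_nhdsWithin_iff] at hiso
  have hDr : ∀ᶠ w in 𝓝 (r : ℂ), w ∈ D := hD.1.mem_nhds hr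
  -- Real points of `D` accumulate at `r`, against isolation of the zeros.
  have h := (Complex.continuous_ofReal.tendsto r).eventually (hiso.and hDr)
  obtain ⟨t, ht, htr⟩ := ((h.filter_mono nhdsWithin_le_nhds).and
    (self_mem_nhdsWithin : {r}ᶜ ∈ 𝓝[≠] r)).exists
  exact ht.1 (by simpa using htr) (hreal t ht.2)

/-- If the normal function of `f` vanishes identically on a product domain, then the zeros of `f`
form, up to the degenerate set, a real analytic surface of singular points. -/
lemma exists_surface {D : Set ℂ} (hD : IsProductDomain D) (hDne : D.Nonempty)
    {F : ℂ → OctonionC} {f : Octonion → Octonion} (hs : IsStem D F) (hh : IsHolomorphic D F)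
    (hF : Induces D F f) (hne : ¬ ∀ z ∈ D, coordinates (F z) = 0)
    (hq : ∀ z ∈ D, quad (coordinates (F z)) = 0) :
    ∃ W : Set Octonion, W ⊆ fiber (circ D) f 0 ∧ IsRealAnalyticSubset (circ D) W ∧
      IsRealAnalyticSurface W ∧
      fiber (circ D) f 0 \ degenerateSet (circ D) f = W \ degenerateSet (circ D) f ∧
      (∀ x ∈ fiber (circ D) f 0 ∩ degenerateSet (circ D) f,
        IsIsolatedIn (sphere x) (fiber (circ D) f 0 ∩ degenerateSet (circ D) f)) ∧
      ∀ x ∈ W, ∃ L : Octonion →L[ℝ] Octonion, HasFDerivAt f L x ∧ ¬ Function.Bijective L := by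
  have hiso : ∀ z ∈ D, ∀ᶠ w in 𝓝[≠] z, coordinates (F w) ≠ 0 := fun z hz =>
    eventually_ne_zero_of_exists_ne (Or.inr hD) (hh.analyticOnNhd hD.1)
      (fun z hz => hs.coordinates_conj hz) hne hz
  obtain ⟨J, hJa, hJ⟩ := exists_analyticOnNhd_unit hD.1 (hh.analyticOnNhd hD.1) hiso hq
  obtain ⟨ho, hc, hr, -⟩ := hD
  have him : ∀ z ∈ D, z.im ≠ 0 := fun z hz h0 => hr z.re (by
    rwa [show (z.re : ℂ) = z from Complex.ext rfl (by simp [h0])])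
  -- As `D` misses the real axis, `proj` maps `Ω` into `V`, so `V` parametrizes the spheres of `Ω`.
  set V : Set ℂ := D ∩ {z | 0 < z.im} with hVdef
  have hV : IsOpen V := ho.inter (isOpen_lt continuous_const Complex.continuous_im)
  have hVne : V.Nonempty := by
    obtain ⟨z, hz⟩ := hDne
    rcases lt_or_gt_of_ne (him z hz) with h | h
    · exact ⟨_, hc z hz, by simpa using h⟩
    · exact ⟨z, hz, h⟩
  have hpos : ∀ z ∈ V, 0 < z.im := fun z hz => hz.2
  have hu : ∀ z ∈ V, J z ∈ units := fun z hz => (hJ z hz.1).1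
  have hJV : AnalyticOnNhd ℝ J V := hJa.mono Set.inter_subset_left
  have hΩ : ∀ x, x ∈ circ D ↔ proj x ∈ V := fun x => by
    rw [mem_circ_iff hc]
    exact ⟨fun h => ⟨h, (norm_nonneg _).lt_of_ne' (him _ h)⟩, fun h => h.1⟩
  have hmem : ∀ z ∈ V, unitSection J z ∈ fiber (circ D) f 0 := fun z hz => by
    refine ⟨⟨z, hz.1, J z, hu z hz, rfl⟩, ?_⟩
    have := (hJ z hz.1).2
    rw [coordinates, rePart_coord, imPart_coord] at this
    rw [unitSection, hF (J z) (hu z hz) z hz.1]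
    exact this
  refine ⟨unitSection J '' V, Set.image_subset_iff.2 hmem,
    isRealAnalyticSubset_image hpos hu hJV hΩ, isRealAnalyticSurface_image hVne hV hpos hu hJV,
    ?_, fun x hx => degenerate_fiber_isolated hc hF hiso hx, ?_⟩
  -- Off the degenerate set the second component is nonzero, so a fiber point must be the point of
  -- the section on its sphere.
  · refine Set.Subset.antisymm (fun x hx => ⟨?_, hx.2⟩)
      (Set.sdiff_subset_sdiff_left (Set.image_subset_iff.2 hmem))
    have hxV := (hΩ x).1 hx.1.1
    have h0 : (F (proj x)).snd ≠ 0 := fun h0 => hx.2 <| (mem_degenerateSet_iff hc hF).2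
      ⟨⟨hx.1.1, by rw [mem_reals_iff_proj]; exact (hpos _ hxV).ne'⟩, h0⟩
    exact (mem_image_unitSection_iff hpos hu hxV).2
      (fiber_eq_of_proj_eq hc hF hx.1 (hmem _ hxV) (proj_unitSection hu hxV (hpos _ hxV).le) h0)
  · rintro _ ⟨z, hz, rfl⟩
    have hr : unitSection J z ∉ reals := by
      rw [mem_reals_iff_proj, proj_unitSection hu hz (hpos z hz).le]
      exact (hpos z hz).ne'
    have hL := (hF.analyticAt hc ho hh (hmem z hz).1 hr).differentiableAt.hasFDerivAt
    exact ⟨_, hL, not_bijective_of_eventually_const hL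
      (analyticAt_unitSection (hJV z hz)).differentiableAt
      (injective_fderiv_unitSection hV hpos hu hJV hz)
      (Filter.mem_of_superset (hV.mem_nhds hz) fun w hw => (hmem w hw).2)⟩

end SliceReg

end

theorem mainTheorem4 (D : Set ℂ) (hD : IsSliceDomain D ∨ IsProductDomain D)
    (f : Octonion → Octonion) (hf : IsSliceRegular D f)
    (hnc : ¬ ∃ a : Octonion, ∀ x ∈ circ D, f x = a)
    (c : Octonion) (hc : c ∈ f '' circ D) :
    ((¬ ∀ x ∈ circ D, normalFun D (fun y => f y - c) x = 0) →
      (∀ x ∈ fiber (circ D) f c,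
        IsIsolatedIn {x} (fiber (circ D) f c) ∨
          (x ∉ Octonion.reals ∧ IsIsolatedIn (Octonion.sphere x) (fiber (circ D) f c))) ∧
      ⋃₀ {S : Set Octonion | ∃ x₀ ∈ circ D \ Octonion.reals, S = Octonion.sphere x₀ ∧
          IsIsolatedIn S (fiber (circ D) f c)} =
        fiber (circ D) f c ∩ degenerateSet (circ D) f) ∧
    ((∀ x ∈ circ D, normalFun D (fun y => f y - c) x = 0) →
      ∃ W : Set Octonion,
        W ⊆ fiber (circ D) f c ∧
        IsRealAnalyticSubset (circ D) W ∧
        IsRealAnalyticSurface W ∧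
        fiber (circ D) f c \ degenerateSet (circ D) f = W \ degenerateSet (circ D) f ∧
        (∀ x ∈ fiber (circ D) f c ∩ degenerateSet (circ D) f,
          IsIsolatedIn (Octonion.sphere x)
            (fiber (circ D) f c ∩ degenerateSet (circ D) f)) ∧
        W ⊆ singularSet (circ D) f) ∧
    (IsSliceDomain D → ¬ ∀ x ∈ circ D, normalFun D (fun y => f y - c) x = 0) := by
  obtain ⟨F, hs, hh, hF⟩ := hf
  have hne := hF.exists_coordinates_ne_zero hnc c
  replace hs := hs.subStem c
  replace hh := hh.subStem c
  replace hF := hF.subStem c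
  have hc' : ConjInvariant D := hD.elim (fun h => h.2.1) fun h => h.2.1
  have ho : IsOpen D := hD.elim (fun h => h.1) fun h => h.1
  have hslice : IsSliceDomain D → ¬ ∀ x ∈ circ D, normalFun D (fun y => f y - c) x = 0 :=
    fun h => by
      rw [normalFun_eq_zero_forall_iff hc' hs hF]
      exact h.exists_quad_ne_zero hs hh hne
  refine ⟨fun hN => ?_, fun hN => ?_, hslice⟩
  · rw [normalFun_eq_zero_forall_iff hc' hs hF] at hN
    have hiso : ∀ z ∈ D, ∀ᶠ w in nhdsWithin z {z}ᶜ,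
        Octonion.quad (OctonionC.coordinates (subStem F c w)) ≠ 0 := fun z hz =>
      eventually_ne_zero_of_exists_ne hD
        (fun z hz => (Octonion.analyticAt_quad _).fun_comp (hh.analyticOnNhd ho z hz))
        (fun z hz => hs.quad_conj hz) hN hz
    rw [← fiber_sub_const, ← degenerateSet_sub_const (circ D) f c]
    refine ⟨fun x hx => ?_, sUnion_isolated_spheres hc' hF hiso⟩
    have h := fiber_isolated hc' hF hiso hx
    by_cases hr : x ∈ Octonion.reals
    · exact Or.inl (h.1 (Or.inr hr))
    by_cases h0 : (subStem F c (Octonion.proj x)).snd = 0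
    · exact Or.inr ⟨hr, h.2 h0⟩
    · exact Or.inl (h.1 (Or.inl h0))
  -- The slice case was excluded by `hslice`, so the surface construction has a domain without real
  -- points.
  · have hp : IsProductDomain D := hD.resolve_left fun h => hslice h hN
    rw [normalFun_eq_zero_forall_iff hc' hs hF] at hN
    have hDne : D.Nonempty := by
      obtain ⟨_, ⟨z, hz, -⟩, -⟩ := hc
      exact ⟨z, hz⟩
    obtain ⟨W, h1, h2, h3, h4, h5, h6⟩ := exists_surface hp hDne hs hh hF hne hN
    rw [fiber_sub_const] at h1 h4 h5
    rw [degenerateSet_sub_const] at h4 h5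
    refine ⟨W, h1, h2, h3, h4, h5, fun x hx => ⟨(h1 hx).1, ?_⟩⟩
    obtain ⟨L, hL, hb⟩ := h6 x hx
    exact ⟨L, by simpa using hL.add_const c, hb⟩
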